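/- Let $X$ be a complex Banach space with open unit ball $B_X$, and let $\mathcal A$ be either $\mathcal A_u(B_X)$ (the uniformly continuous holomorphic functions $B_X\to\mathbb C$) or $\mathcal H^\infty(B_X)$ (the bounded holomorphic functions $B_X\to\mathbb C$), with the supremum norm. Let $\mathcal M(\mathcal A)$ be the set of nonzero homomorphisms $\mathcal A\to\mathbb C$. For $\varphi,\psi\in\mathcal M(\mathcal A)$ put $\rho(\varphi,\psi)=\sup\{|\varphi(f)| : f\in\mathcal A,\ \|f\|\le 1,\ \psi(f)=0\}$, and let $\mathcal{GP}(\varphi)=\{\psi\in\mathcal M(\mathcal A) : \rho(\varphi,\psi)<1\}$ be the Gleason part of $\varphi$. For $z$ in the open unit ball $B_{X^{**}}$ of the bidual let $\delta_z(f)=\tilde f(z)$, where $\tilde f$ is the canonical (Aron–Berner, Davie–Gamelin) extension of $f$ to $B_{X^{**}}$: $\tilde f=\sum_n\tilde P_n$, where $f=\sum_n P_n$ is the Taylor series of $f$ at $0$ and $\tilde P_n(z)=\tilde A_n(z,\dots,z)$, with $\tilde A_n$ the extension to $X^{**}$, one variable at a time by weak-star limits, of the symmetric $n$-linear form $A_n$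 of $P_n$. Let $\mathcal M_0=\{\varphi\in\mathcal M(\mathcal A) : \varphi|_{X^*}=0\}$ be the fiber over $0$, where $X^*\subset\mathcal A$ by restriction to $B_X$. Suppose that there is a norm continuous polynomial $P\colon X\to\mathbb C$ whose restriction to $B_X$ is not weakly continuous. Then $B_{X^{**}}\subsetneqq\mathcal{GP}(\delta_0)$, where $z\in B_{X^{**}}$ is identified with $\delta_z$; that is, $z\mapsto\delta_z$ is injective on $B_{X^{**}}$, each $\delta_z$ with $z\in B_{X^{**}}$ is an element of $\mathcal{GP}(\delta_0)$, and $\{\delta_z : z\in B_{X^{**}}\}\neq\mathcal{GP}(\delta_0)$. Moreover, there is $\varphi\in\mathcal M_0\cap\mathcal{GP}(\delta_0)$ with $\varphi\neq\delta_0$. -/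

import Mathlib

noncomputable section

open Metric

namespace GleasonParts

/-- `P` is a continuous polynomial on `X`: a finite sum of restrictions to the diagonal of
continuous `k`-linear forms. -/
def IsContinuousPolynomial {X : Type*} [NormedAddCommGroup X] [NormedSpace ℂ X]
    (P : X → ℂ) : Prop :=
  ∃ (N : ℕ) (A : (k : ℕ) → ContinuousMultilinearMap ℂ (fun _ : Fin k => X) ℂ),
    ∀ x : X, P x = ∑ k ∈ Finset.range (N + 1), A k (fun _ => x)

/-- `P` restricted to the open unit ball is continuous for the weak topology of `X`. -/
def IsWeaklyContinuousOnBall {X : Type*} [NormedAddCommGroup X] [NormedSpace ℂ X]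
    (P : X → ℂ) : Prop :=
  ContinuousOn (fun y : WeakSpace ℂ X => P ((toWeakSpace ℂ X).symm y))
    (toWeakSpace ℂ X '' ball (0 : X) 1)

/-- Bounded continuous functions on the open unit ball, with the supremum norm. -/
abbrev BallFun (X : Type*) [NormedAddCommGroup X] [NormedSpace ℂ X] : Type _ :=
  BoundedContinuousFunction (ball (0 : X) 1) ℂ

open Classical in
/-- Extension by zero of a function on the open unit ball. Only its values in the ball matter. -/
def zeroExt {X : Type*} [NormedAddCommGroup X] [NormedSpace ℂ X] (f : BallFun X) (x : X) : ℂ :=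
  if h : x ∈ ball (0 : X) 1 then f ⟨x, h⟩ else 0

theorem zeroExt_of_mem {X : Type*} [NormedAddCommGroup X] [NormedSpace ℂ X] (f : BallFun X)
    {x : X} (h : x ∈ ball (0 : X) 1) : zeroExt f x = f ⟨x, h⟩ := by
  simp only [zeroExt, dif_pos h]

/-- `H^∞(B_X)`: the algebra of bounded holomorphic functions on the open unit ball. -/
def Hinf (X : Type*) [NormedAddCommGroup X] [NormedSpace ℂ X] : Subalgebra ℂ (BallFun X) where
  carrier := {f | DifferentiableOn ℂ (zeroExt f) (ball (0 : X) 1)}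
  mul_mem' {f g} hf hg := by
    refine (DifferentiableOn.mul hf hg).congr fun x hx => ?_
    simp [zeroExt_of_mem _ hx]
  add_mem' {f g} hf hg := by
    refine (DifferentiableOn.add hf hg).congr fun x hx => ?_
    simp [zeroExt_of_mem _ hx]
  algebraMap_mem' c := by
    refine (differentiableOn_const c).congr fun x hx => ?_
    simp [zeroExt_of_mem _ hx]

/-- `A_u(B_X)`: the algebra of uniformly continuous holomorphic functions on the open unit ball
(these are automatically bounded). -/
def Au (X : Type*) [NormedAddCommGroup X] [NormedSpace ℂ X] : Subalgebra ℂ (BallFun X) where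
  carrier := {f | f ∈ Hinf X ∧ UniformContinuous f}
  mul_mem' {f g} hf hg := by
    refine ⟨mul_mem hf.1 hg.1, ?_⟩
    have hf2 := Metric.uniformContinuous_iff.1 hf.2
    have hg2 := Metric.uniformContinuous_iff.1 hg.2
    refine Metric.uniformContinuous_iff.2 fun ε hε => ?_
    have hK : 0 < ‖f‖ + ‖g‖ + 1 := by positivity
    obtain ⟨d₁, hd₁, h₁⟩ := hf2 (ε / (‖f‖ + ‖g‖ + 1)) (by positivity)
    obtain ⟨d₂, hd₂, h₂⟩ := hg2 (ε / (‖f‖ + ‖g‖ + 1)) (by positivity)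
    refine ⟨min d₁ d₂, lt_min hd₁ hd₂, fun a b hab => ?_⟩
    have e₁ := h₁ (lt_of_lt_of_le hab (min_le_left _ _))
    have e₂ := h₂ (lt_of_lt_of_le hab (min_le_right _ _))
    rw [dist_eq_norm] at e₁ e₂ ⊢
    have key : (f * g) a - (f * g) b = f a * (g a - g b) + (f a - f b) * g b := by
      simp only [BoundedContinuousFunction.mul_apply]; ring
    rw [key]
    calc ‖f a * (g a - g b) + (f a - f b) * g b‖
        ≤ ‖f a‖ * ‖g a - g b‖ + ‖f a - f b‖ * ‖g b‖ := by
          simpa only [norm_mul] using norm_add_le (f a * (g a - g b)) ((f a - f b) * g b)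
      _ ≤ ‖f‖ * (ε / (‖f‖ + ‖g‖ + 1)) + (ε / (‖f‖ + ‖g‖ + 1)) * ‖g‖ := by
          gcongr
          · exact f.norm_coe_le_norm a
          · exact g.norm_coe_le_norm b
      _ = ε * ((‖f‖ + ‖g‖) / (‖f‖ + ‖g‖ + 1)) := by ring
      _ < ε * 1 := by
          gcongr
          rw [div_lt_one hK]
          linarith
      _ = ε := mul_one ε
  add_mem' {f g} hf hg := ⟨add_mem hf.1 hg.1, hf.2.add hg.2⟩
  algebraMap_mem' c := ⟨algebraMap_mem _ c, uniformContinuous_const⟩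

theorem Au_le_Hinf (X : Type*) [NormedAddCommGroup X] [NormedSpace ℂ X] : Au X ≤ Hinf X :=
  fun _ hf => hf.1

/-! ### The spectrum, the pseudo-hyperbolic distance and Gleason parts -/

/-- `ρ(φ, ψ) = sup {|φ(f)| : ‖f‖ ≤ 1, ψ(f) = 0}`. -/
def pseudoHyperbolicDist {A : Type*} [NormedRing A] [NormedAlgebra ℂ A]
    (φ ψ : WeakDual.characterSpace ℂ A) : ℝ :=
  sSup {r : ℝ | ∃ f : A, ‖f‖ ≤ 1 ∧ ψ f = 0 ∧ r = ‖φ f‖}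

/-- The Gleason part of `φ`. -/
def gleasonPart {A : Type*} [NormedRing A] [NormedAlgebra ℂ A]
    (φ : WeakDual.characterSpace ℂ A) : Set (WeakDual.characterSpace ℂ A) :=
  {ψ | pseudoHyperbolicDist φ ψ < 1}

/-- Evaluation at the origin, as a point of the spectrum. -/
def deltaZero {X : Type*} [NormedAddCommGroup X] [NormedSpace ℂ X]
    (𝒜 : Subalgebra ℂ (BallFun X)) : WeakDual.characterSpace ℂ 𝒜 :=
  ⟨StrongDual.toWeakDual
      ((BoundedContinuousFunction.evalCLM ℂ (⟨0, mem_ball_self one_pos⟩ : ball (0 : X) 1)).comp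
        (Subalgebra.toSubmodule 𝒜).subtypeL),
    fun h => one_ne_zero (α := ℂ) (DFunLike.congr_fun h (1 : 𝒜)), fun _ _ => rfl⟩

/-! ### The inclusion `X* ⊂ A` and the projection onto the closed ball of the bidual -/

/-- The restriction of a continuous linear functional to the open unit ball. -/
def dualRestrict {X : Type*} [NormedAddCommGroup X] [NormedSpace ℂ X]
    (l : StrongDual ℂ X) : BallFun X :=
  BoundedContinuousFunction.ofNormedAddCommGroup (fun x : ball (0 : X) 1 => l x)
    (l.continuous.comp continuous_subtype_val) ‖l‖ fun x => by
      have hx : ‖(x : X)‖ ≤ 1 := (mem_ball_zero_iff.1 x.2).le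
      exact (l.le_opNorm x).trans (mul_le_of_le_one_right (norm_nonneg l) hx)

theorem dualRestrict_mem_Au {X : Type*} [NormedAddCommGroup X] [NormedSpace ℂ X]
    (l : StrongDual ℂ X) : dualRestrict l ∈ Au X := by
  refine ⟨l.differentiable.differentiableOn.congr fun x hx => ?_,
    l.uniformContinuous.comp uniformContinuous_subtype_val⟩
  rw [zeroExt_of_mem _ hx]
  rfl

/-- The inclusion of `X*` into an algebra `𝒜` containing `A_u(B_X)`
(`𝒜 = A_u(B_X)` or `𝒜 = H^∞(B_X)`). -/
def dualIncl {X : Type*} [NormedAddCommGroup X] [NormedSpace ℂ X]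
    (𝒜 : Subalgebra ℂ (BallFun X)) (h𝒜 : Au X ≤ 𝒜) : StrongDual ℂ X →L[ℂ] 𝒜 :=
  LinearMap.mkContinuous
    { toFun := fun l => ⟨dualRestrict l, h𝒜 (dualRestrict_mem_Au l)⟩
      map_add' := fun _ _ => rfl
      map_smul' := fun _ _ => rfl } 1 fun l => by
    rw [one_mul]
    change ‖dualRestrict l‖ ≤ ‖l‖
    refine (BoundedContinuousFunction.norm_le (norm_nonneg l)).2 fun x => ?_
    have hx : ‖(x : X)‖ ≤ 1 := (mem_ball_zero_iff.1 x.2).le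
    exact (l.le_opNorm x).trans (mul_le_of_le_one_right (norm_nonneg l) hx)

/-- `π(φ) = φ|_{X*}`, an element of the bidual. -/
def projBidual {X : Type*} [NormedAddCommGroup X] [NormedSpace ℂ X]
    (𝒜 : Subalgebra ℂ (BallFun X)) (h𝒜 : Au X ≤ 𝒜) (φ : WeakDual.characterSpace ℂ 𝒜) :
    StrongDual ℂ (StrongDual ℂ X) :=
  (WeakDual.toStrongDual (φ : WeakDual ℂ 𝒜)).comp (dualIncl 𝒜 h𝒜)

/-- The fiber `M_z` over `z`. -/
def fiber {X : Type*} [NormedAddCommGroup X] [NormedSpace ℂ X]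
    (𝒜 : Subalgebra ℂ (BallFun X)) (h𝒜 : Au X ≤ 𝒜) (z : StrongDual ℂ (StrongDual ℂ X)) :
    Set (WeakDual.characterSpace ℂ 𝒜) :=
  {φ | projBidual 𝒜 h𝒜 φ = z}

/-! ### The canonical (Aron–Berner, Davie–Gamelin) extension to the bidual -/

/-- `aronBerner n z A` is the value at `(z 0, …, z (n-1))` of the canonical extension of the
`n`-linear form `A` to the bidual, obtained by extending one variable at a time:
`Ã(z₀, …, zₙ₋₁) = z₀ (x ↦ (A(x, ·))~(z₁, …, zₙ₋₁))`, i.e. the iterated weak-star limit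
`lim_{x₀ → z₀} ⋯ lim_{xₙ₋₁ → zₙ₋₁} A(x₀, …, xₙ₋₁)` over points of `X`. -/
def aronBerner {X : Type*} [NormedAddCommGroup X] [NormedSpace ℂ X] :
    (n : ℕ) → (Fin n → StrongDual ℂ (StrongDual ℂ X)) →
      (ContinuousMultilinearMap ℂ (fun _ : Fin n => X) ℂ →L[ℂ] ℂ)
  | 0, _ => ContinuousMultilinearMap.apply ℂ (fun _ : Fin 0 => X) ℂ 0
  | n + 1, z =>
    (z 0).comp
      ((ContinuousLinearMap.compL ℂ X (ContinuousMultilinearMap ℂ (fun _ : Fin n => X) ℂ) ℂ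
          (aronBerner n (Fin.tail z))).comp
        (continuousMultilinearCurryLeftEquiv ℂ
          (fun _ : Fin (n + 1) => X) ℂ).toContinuousLinearEquiv.toContinuousLinearMap)

theorem aronBerner_succ_apply {X : Type*} [NormedAddCommGroup X] [NormedSpace ℂ X] (n : ℕ)
    (z : Fin (n + 1) → StrongDual ℂ (StrongDual ℂ X))
    (A : ContinuousMultilinearMap ℂ (fun _ : Fin (n + 1) => X) ℂ) :
    aronBerner (n + 1) z A = z 0 ((aronBerner n (Fin.tail z)).comp A.curryLeft) :=
  rfl

/-- The canonical extension `f̃(z)`, `‖z‖ < 1`, of a bounded holomorphic function `f` on the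
ball: with `f = ∑ Pₙ` the Taylor series at `0`, where `Pₙ(x) = Dⁿf(0)(x, …, x) / n!` and `Dⁿf(0)`
is symmetric, `f̃(z) = ∑ P̃ₙ(z)`. -/
def canonicalExt {X : Type*} [NormedAddCommGroup X] [NormedSpace ℂ X] (f : BallFun X)
    (z : StrongDual ℂ (StrongDual ℂ X)) : ℂ :=
  ∑' n : ℕ, ((n.factorial : ℂ))⁻¹ * aronBerner n (fun _ => z) (iteratedFDeriv ℂ n (zeroExt f) 0)

/-- The evaluation `δ_z : f ↦ f̃(z)` on the algebra `𝒜`, as a function `𝒜 → ℂ`. -/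
def delta {X : Type*} [NormedAddCommGroup X] [NormedSpace ℂ X]
    (𝒜 : Subalgebra ℂ (BallFun X)) (z : StrongDual ℂ (StrongDual ℂ X)) : 𝒜 → ℂ :=
  fun f => canonicalExt (f : BallFun X) z

end GleasonParts

end

/-!
A character that is a limit of evaluations at points of `rB_X`, with `r < 1`, lies in the Gleason
part of `δ₀`: by the Schwarz–Pick inequality `|f(x) - f(0)| ≤ r |1 - conj(f(0)) f(x)|` for `‖f‖ ≤ 1`
and `‖x‖ ≤ r`, and this survives in the limit.

For `‖z‖ < 1`, the evaluation `δ_z` is such a limit. Goldstine's theorem gives a net in `rB_X`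
converging weak-star to `z`; by the averaging argument of Davie and Gamelin, means of many generic
points of the net approximate the Aron–Berner extension of every symmetric form on the diagonal,
because only few of the terms in the multilinear expansion have repeated arguments. The Taylor
series passes to the limit by dominated convergence.

If `P` is weakly discontinuous at `x₀` along an ultrafilter in the ball, then `y ↦ P (x₀ + 4y)`
separates `δ₀` from the limit of the evaluations at `(x - x₀) / 4`. These points converge weakly
to `0` in `½B_X`, so the limit lies in the fiber over `0` and in the Gleason part of `δ₀`, whereas
`δ₀` is the only `δ_z` in that fiber.
-/

noncomputable section

open Metric Set Filter Topology Asymptotics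

namespace GleasonParts

section Holomorphic

variable {E : Type*} [NormedAddCommGroup E] [NormedSpace ℂ E]
  {F : Type*} [NormedAddCommGroup F] [NormedSpace ℂ F]

theorem norm_fderiv_le_of_norm_le {f : E → F} {c : E} {R M : ℝ} (hR : 0 < R)
    (hd : DifferentiableOn ℂ f (ball c R)) (hM : ∀ x ∈ ball c R, ‖f x‖ ≤ M) :
    ‖fderiv ℂ f c‖ ≤ 2 * M / R := by
  refine Complex.norm_fderiv_le_div_of_mapsTo_ball hd (fun x hx => ?_) hR
  rw [mem_closedBall, dist_eq_norm]
  linarith [norm_sub_le (f x) (f c), hM x hx, hM c (mem_ball_self hR)]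

theorem norm_image_sub_le_of_norm_le {f : E → F} {c : E} {r R M : ℝ} (hR : r < R)
    (hd : DifferentiableOn ℂ f (ball c R)) (hM : ∀ x ∈ ball c R, ‖f x‖ ≤ M) {x y : E}
    (hx : x ∈ ball c r) (hy : y ∈ ball c r) : ‖f y - f x‖ ≤ 2 * M / (R - r) * ‖y - x‖ := by
  refine (convex_ball c r).norm_image_sub_le_of_norm_fderiv_le (𝕜 := ℂ)
    (fun w hw => hd.differentiableAt (isOpen_ball.mem_nhds (ball_subset_ball hR.le hw)))
    (fun w hw => ?_) hx hy
  have hsub : ball w (R - r) ⊆ ball c R := ball_subset_ball' (by linarith [mem_ball.1 hw])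
  exact norm_fderiv_le_of_norm_le (sub_pos.2 hR) (hd.mono hsub) fun v hv => hM v (hsub hv)

theorem norm_sub_sub_fderiv_le {f : E → F} {c : E} {R M : ℝ} (hR : 0 < R)
    (hd : DifferentiableOn ℂ f (ball c R)) (hM : ∀ x ∈ ball c R, ‖f x‖ ≤ M)
    {h : E} (hh : ‖h‖ < R) :
    ‖f (c + h) - f c - fderiv ℂ f c h‖ ≤ 4 * M * (‖h‖ / R) ^ 2 := by
  have hM0 : 0 ≤ M := (norm_nonneg _).trans (hM c (mem_ball_self hR))
  have hdc : DifferentiableAt ℂ f c := hd.differentiableAt (ball_mem_nhds c hR)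
  let g : E → F := fun x => f x - fderiv ℂ f c (x - c)
  have hg_sub : ∀ x, g x - g c = f x - f c - fderiv ℂ f c (x - c) := fun x => by
    simp only [g, sub_self, map_zero, sub_zero]; abel
  have hgd : DifferentiableOn ℂ g (ball c R) :=
    hd.sub ((fderiv ℂ f c).differentiable.comp (differentiable_id.sub_const c)).differentiableOn
  have hmaps : MapsTo g (ball c R) (closedBall (g c) (4 * M)) := by
    intro x hx
    have hlin : ‖fderiv ℂ f c (x - c)‖ ≤ 2 * M := by
      refine ((fderiv ℂ f c).le_of_opNorm_le (norm_fderiv_le_of_norm_le hR hd hM) _).trans ?_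
      calc 2 * M / R * ‖x - c‖ ≤ 2 * M / R * R := by gcongr; exact (mem_ball_iff_norm.1 hx).le
        _ = 2 * M := by field_simp
    rw [mem_closedBall, dist_eq_norm, hg_sub]
    linarith [norm_sub_le (f x - f c) (fderiv ℂ f c (x - c)), norm_sub_le (f x) (f c), hM x hx,
      hM c (mem_ball_self hR)]
  have ho : (g · - g c) =o[𝓝 c] (fun w ↦ ‖w - c‖ ^ 1) := by
    simp only [pow_one, hg_sub]
    exact hdc.hasFDerivAt.isLittleO.norm_right
  have := Complex.dist_le_mul_div_pow_of_mapsTo_ball_of_isLittleO (z := c + h) hgd hmaps ho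
    (by simpa using hh)
  simpa [dist_eq_norm, hg_sub] using this

theorem hasFDerivAt_of_norm_sub_sub_le {f : E → F} {L : E →L[ℂ] F} {c : E} {R C : ℝ} (hR : 0 < R)
    (h : ∀ v : E, ‖v‖ < R → ‖f (c + v) - f c - L v‖ ≤ C * ‖v‖ ^ 2) : HasFDerivAt f L c := by
  rw [hasFDerivAt_iff_isLittleO_nhds_zero]
  have hO : (fun v : E => f (c + v) - f c - L v) =O[𝓝 0] fun v : E => ‖v‖ ^ 2 := by
    refine IsBigO.of_bound C ?_
    filter_upwards [ball_mem_nhds (0 : E) hR] with v hv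
    simpa using h v (mem_ball_zero_iff.1 hv)
  exact hO.trans_isLittleO (isLittleO_norm_pow_id one_lt_two)

theorem exists_tendsto_fderiv_of_tendstoUniformlyOn [CompleteSpace F] {ι : Type*} {l : Filter ι}
    [l.NeBot] {f : ι → E → F} {g : E → F} {c : E} {R : ℝ} (hR : 0 < R)
    (hd : ∀ᶠ i in l, DifferentiableOn ℂ (f i) (ball c R))
    (hu : TendstoUniformlyOn f g l (ball c R)) :
    ∃ L : E →L[ℂ] F, Tendsto (fun i => fderiv ℂ (f i) c) l (𝓝 L) := by
  refine cauchy_map_iff_exists_tendsto.1 (cauchy_map_iff.2 ⟨‹_›,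
    Metric.uniformity_basis_dist.tendsto_right_iff.2 fun ε hε => ?_⟩)
  have hclose := hd.and (Metric.tendstoUniformlyOn_iff.1 hu (ε * R / 8) (by positivity))
  filter_upwards [hclose.prod_mk hclose] with ⟨i, j⟩ ⟨⟨hdi, hgi⟩, hdj, hgj⟩
  have hsub : ∀ x ∈ ball c R, ‖(f i - f j) x‖ ≤ ε * R / 4 := fun x hx => by
    rw [Pi.sub_apply, ← dist_eq_norm]
    linarith [hgi x hx, hgj x hx, dist_triangle_left (f i x) (f j x) (g x)]
  have hfderiv := norm_fderiv_le_of_norm_le hR (hdi.sub hdj) hsub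
  have hc : ball c R ∈ 𝓝 c := ball_mem_nhds c hR
  rw [fderiv_sub (hdi.differentiableAt hc) (hdj.differentiableAt hc), ← dist_eq_norm] at hfderiv
  refine hfderiv.trans_lt ?_
  rw [div_lt_iff₀ hR]
  linarith [mul_pos hε hR]

theorem differentiableAt_of_tendstoUniformlyOn [CompleteSpace F] {ι : Type*} {l : Filter ι}
    [l.NeBot] {f : ι → E → F} {g : E → F} {c : E} {R M : ℝ} (hR : 0 < R)
    (hd : ∀ᶠ i in l, DifferentiableOn ℂ (f i) (ball c R))
    (hM : ∀ x ∈ ball c R, ‖g x‖ ≤ M)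
    (hu : TendstoUniformlyOn f g l (ball c R)) : DifferentiableAt ℂ g c := by
  obtain ⟨L, hL⟩ := exists_tendsto_fderiv_of_tendstoUniformlyOn hR hd hu
  have hbd : ∀ᶠ i in l, ∀ x ∈ ball c R, ‖f i x‖ ≤ M + 1 := by
    filter_upwards [Metric.tendstoUniformlyOn_iff.1 hu 1 one_pos] with i hi x hx
    have hfg := (hi x hx).le
    rw [dist_comm, dist_eq_norm] at hfg
    linarith [norm_le_norm_add_norm_sub' (f i x) (g x), hM x hx]
  refine (hasFDerivAt_of_norm_sub_sub_le (L := L) (C := 4 * (M + 1) / R ^ 2) hR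
    fun v hv => ?_).differentiableAt
  have hlim : Tendsto (fun i => f i (c + v) - f i c - fderiv ℂ (f i) c v) l
      (𝓝 (g (c + v) - g c - L v)) :=
    ((hu.tendsto_at (by simpa using hv)).sub (hu.tendsto_at (mem_ball_self hR))).sub
      (((ContinuousLinearMap.apply ℂ F v).continuous.tendsto L).comp hL)
  refine le_of_tendsto hlim.norm ?_
  filter_upwards [hd, hbd] with i hdi hbi
  refine (norm_sub_sub_fderiv_le hR hdi hbi hv).trans_eq ?_
  ring

theorem ball_half_subset_ball {E : Type*} [PseudoMetricSpace E] {c y : E} {R : ℝ}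
    (hy : y ∈ ball c (R / 2)) : ball y (R / 2) ⊆ ball c R :=
  ball_subset_ball' (by linarith [mem_ball.1 hy])

theorem tendstoUniformlyOn_difference_quotient {f : E → F} {c : E} {R M : ℝ} (hR : 0 < R)
    (hd : DifferentiableOn ℂ f (ball c R)) (hM : ∀ x ∈ ball c R, ‖f x‖ ≤ M) (v : E) :
    TendstoUniformlyOn (fun (t : ℂ) y => t⁻¹ • (f (y + t • v) - f y)) (fun y => fderiv ℂ f y v)
      (𝓝[≠] 0) (ball c (R / 2)) := by
  have hR2 : 0 < R / 2 := half_pos hR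
  rw [Metric.tendstoUniformlyOn_iff]
  intro ε hε
  have hsmall : ∀ᶠ t : ℂ in 𝓝 0, ‖t • v‖ < R / 2 :=
    Continuous.tendsto' (by fun_prop) 0 0 (by simp) |>.eventually_lt_const hR2
  have hbound : ∀ᶠ t : ℂ in 𝓝 0, 4 * M * ‖t‖ * (‖v‖ / (R / 2)) ^ 2 < ε :=
    Continuous.tendsto' (by fun_prop) 0 0 (by simp) |>.eventually_lt_const hε
  filter_upwards [self_mem_nhdsWithin, nhdsWithin_le_nhds hsmall, nhdsWithin_le_nhds hbound]
    with t ht htv htε y hy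
  have ht0 : 0 < ‖t‖ := norm_pos_iff.2 ht
  have hremainder := norm_sub_sub_fderiv_le hR2 (hd.mono (ball_half_subset_ball hy))
    (fun x hx => hM x (ball_half_subset_ball hy hx)) htv
  have hquot : t⁻¹ • (f (y + t • v) - f y) - fderiv ℂ f y v
      = t⁻¹ • (f (y + t • v) - f y - fderiv ℂ f y (t • v)) := by
    rw [smul_sub t⁻¹ _ (fderiv ℂ f y (t • v)), map_smul, inv_smul_smul₀ ht]
  refine lt_of_le_of_lt ?_ htε
  rw [dist_comm, dist_eq_norm, hquot, norm_smul, norm_inv]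
  calc ‖t‖⁻¹ * ‖f (y + t • v) - f y - fderiv ℂ f y (t • v)‖
      ≤ ‖t‖⁻¹ * (4 * M * (‖t • v‖ / (R / 2)) ^ 2) := by gcongr
    _ = 4 * M * ‖t‖ * (‖v‖ / (R / 2)) ^ 2 := by rw [norm_smul]; field_simp

theorem norm_fderiv_apply_le {f : E → F} {c : E} {R M : ℝ} (hR : 0 < R)
    (hd : DifferentiableOn ℂ f (ball c R)) (hM : ∀ x ∈ ball c R, ‖f x‖ ≤ M) (v : E) :
    ∀ y ∈ ball c (R / 2), ‖fderiv ℂ f y v‖ ≤ 4 * M / R * ‖v‖ := fun y hy => by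
  refine (fderiv ℂ f y).le_of_opNorm_le ((norm_fderiv_le_of_norm_le (half_pos hR)
    (hd.mono (ball_half_subset_ball hy)) fun x hx => hM x (ball_half_subset_ball hy hx)).trans_eq
      ?_) v
  ring

theorem differentiableAt_fderiv_apply [CompleteSpace F] {f : E → F} {c : E} {R M : ℝ} (hR : 0 < R)
    (hd : DifferentiableOn ℂ f (ball c R)) (hM : ∀ x ∈ ball c R, ‖f x‖ ≤ M) (v : E) :
    DifferentiableAt ℂ (fun y => fderiv ℂ f y v) c := by
  have hsmall : ∀ᶠ t : ℂ in 𝓝[≠] 0, ‖t • v‖ < R / 2 := nhdsWithin_le_nhds <|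
    Continuous.tendsto' (by fun_prop) 0 0 (by simp) |>.eventually_lt_const (half_pos hR)
  refine differentiableAt_of_tendstoUniformlyOn (half_pos hR) ?_ (norm_fderiv_apply_le hR hd hM v)
    (tendstoUniformlyOn_difference_quotient hR hd hM v)
  filter_upwards [hsmall] with t ht
  refine DifferentiableOn.const_smul (DifferentiableOn.sub ?_ ?_) _
  · exact hd.comp (differentiable_id.add_const _).differentiableOn
      fun y hy => ball_half_subset_ball hy (by simpa using ht)
  · exact hd.mono (ball_subset_ball (by linarith))

theorem differentiableAt_fderiv_of_norm_le [CompleteSpace F] {f : E → F} {c : E} {R M : ℝ}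
    (hR : 0 < R) (hd : DifferentiableOn ℂ f (ball c R)) (hM : ∀ x ∈ ball c R, ‖f x‖ ≤ M) :
    DifferentiableAt ℂ (fderiv ℂ f) c := by
  have hM0 : 0 ≤ M := (norm_nonneg _).trans (hM c (mem_ball_self hR))
  have hR2 : 0 < R / 2 := half_pos hR
  have hdv : ∀ v : E, ∀ y ∈ ball c (R / 2), DifferentiableAt ℂ (fun y => fderiv ℂ f y v) y :=
    fun v y hy => differentiableAt_fderiv_apply hR2 (hd.mono (ball_half_subset_ball hy))
      (fun x hx => hM x (ball_half_subset_ball hy hx)) v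
  have hdc : ∀ v : E, DifferentiableAt ℂ (fun y => fderiv ℂ f y v) c :=
    fun v => hdv v c (mem_ball_self hR2)
  have hdon : ∀ v : E, DifferentiableOn ℂ (fun y => fderiv ℂ f y v) (ball c (R / 2)) :=
    fun v y hy => (hdv v y hy).differentiableWithinAt
  have hbd := norm_fderiv_apply_le hR hd hM
  let D : E →L[ℂ] E →L[ℂ] F := LinearMap.mkContinuous
    { toFun := fun v => fderiv ℂ (fun y => fderiv ℂ f y v) c
      map_add' := fun v w => by
        simp only [map_add]
        exact fderiv_fun_add (hdc v) (hdc w)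
      map_smul' := fun a v => by
        simp only [map_smul, RingHom.id_apply]
        exact fderiv_fun_const_smul (hdc v) a } (2 * (4 * M / R) / (R / 2)) fun v => by
    refine (norm_fderiv_le_of_norm_le hR2 (hdon v) (hbd v)).trans_eq ?_
    ring
  refine (hasFDerivAt_of_norm_sub_sub_le (L := D.flip) (C := 4 * (4 * M / R) / (R / 2) ^ 2) hR2
    fun h hh => ?_).differentiableAt
  refine ContinuousLinearMap.opNorm_le_bound _ (by positivity) fun v => ?_
  calc ‖(fderiv ℂ f (c + h) - fderiv ℂ f c - D.flip h) v‖
      ≤ 4 * (4 * M / R * ‖v‖) * (‖h‖ / (R / 2)) ^ 2 :=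
        norm_sub_sub_fderiv_le hR2 (hdon v) (hbd v) hh
    _ = 4 * (4 * M / R) / (R / 2) ^ 2 * ‖h‖ ^ 2 * ‖v‖ := by ring

theorem exists_ball_norm_le_of_continuousOn {E F : Type*} [PseudoMetricSpace E]
    [SeminormedAddCommGroup F] {f : E → F} {U : Set E} (hU : IsOpen U) (hf : ContinuousOn f U)
    {x : E} (hx : x ∈ U) :
    ∃ R M : ℝ, 0 < R ∧ ball x R ⊆ U ∧ ∀ y ∈ ball x R, ‖f y‖ ≤ M := by
  have hbdd : ∀ᶠ y in 𝓝 x, ‖f y‖ < ‖f x‖ + 1 :=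
    (hf.continuousAt (hU.mem_nhds hx)).norm.eventually_lt_const (lt_add_one _)
  obtain ⟨R, hR, hball⟩ := Metric.mem_nhds_iff.1 (hbdd.and (hU.mem_nhds hx))
  exact ⟨R, ‖f x‖ + 1, hR, fun y hy => (hball hy).2, fun y hy => (hball hy).1.le⟩

theorem differentiableOn_fderiv_of_isOpen [CompleteSpace F] {f : E → F} {U : Set E}
    (hU : IsOpen U) (hd : DifferentiableOn ℂ f U) : DifferentiableOn ℂ (fderiv ℂ f) U := by
  intro x hx
  obtain ⟨R, M, hR, hRU, hM⟩ := exists_ball_norm_le_of_continuousOn hU hd.continuousOn hx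
  exact (differentiableAt_fderiv_of_norm_le hR (hd.mono hRU) hM).differentiableWithinAt

theorem differentiableOn_iteratedFDeriv [CompleteSpace F] {f : E → F} {U : Set E}
    (hU : IsOpen U) (hd : DifferentiableOn ℂ f U) (n : ℕ) :
    DifferentiableOn ℂ (iteratedFDeriv ℂ n f) U := by
  induction n with
  | zero =>
    exact (continuousMultilinearCurryFin0 ℂ E F).symm.differentiable.comp_differentiableOn hd
  | succ n ih =>
    exact (continuousMultilinearCurryLeftEquiv ℂ (fun _ : Fin (n + 1) => E)
      F).symm.differentiable.comp_differentiableOn (differentiableOn_fderiv_of_isOpen hU ih)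

theorem contDiffOn_of_differentiableOn_isOpen [CompleteSpace F] {f : E → F} {U : Set E}
    (hU : IsOpen U) (hd : DifferentiableOn ℂ f U) (n : ℕ) : ContDiffOn ℂ n f U :=
  contDiffOn_of_differentiableOn fun m _ =>
    (differentiableOn_iteratedFDeriv hU hd m).congr (iteratedFDerivWithin_of_isOpen m hU)

theorem norm_iteratedFDeriv_le_of_norm_le [CompleteSpace F] {f : E → F} {c : E} {R ρ M : ℝ} {n : ℕ}
    (hρ : 0 < ρ) (hn : n * ρ < R) (hd : DifferentiableOn ℂ f (ball c R))
    (hM : ∀ x ∈ ball c R, ‖f x‖ ≤ M) : ‖iteratedFDeriv ℂ n f c‖ ≤ (2 / ρ) ^ n * M := by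
  induction n generalizing c R with
  | zero =>
    simpa using hM c (mem_ball_self (by simpa using hn))
  | succ n ih =>
    push_cast at hn
    have hnρ : 0 ≤ n * ρ := by positivity
    have hρR : ρ < R := by linarith
    have hsub : ∀ y ∈ ball c ρ, ball y (R - ρ) ⊆ ball c R := fun y hy =>
      ball_subset_ball' (by linarith [mem_ball.1 hy])
    rw [← norm_fderiv_iteratedFDeriv]
    calc ‖fderiv ℂ (iteratedFDeriv ℂ n f) c‖ ≤ 2 * ((2 / ρ) ^ n * M) / ρ :=
          norm_fderiv_le_of_norm_le hρ
            ((differentiableOn_iteratedFDeriv isOpen_ball hd n).mono (ball_subset_ball hρR.le))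
            fun y hy => ih (by linarith) (hd.mono (hsub y hy)) fun x hx => hM x (hsub y hy hx)
      _ = (2 / ρ) ^ (n + 1) * M := by ring

theorem iteratedDeriv_comp_add_smul [CompleteSpace F] {f : E → F} {U : Set E} {c : E}
    (hU : IsOpen U) (hc : c ∈ U) (hd : DifferentiableOn ℂ f U) (n : ℕ) (x : E) :
    iteratedDeriv n (fun t : ℂ => f (c + t • x)) 0 = iteratedFDeriv ℂ n f c (fun _ => x) := by
  let line : ℂ →L[ℂ] E := ContinuousLinearMap.toSpanSingleton ℂ x
  have hV : IsOpen ((c + ·) ⁻¹' U) := hU.preimage (by fun_prop)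
  have hcV : (0 : E) ∈ (c + ·) ⁻¹' U := by simpa using hc
  have hdV : DifferentiableOn ℂ (fun y => f (c + y)) ((c + ·) ⁻¹' U) :=
    hd.comp (differentiable_id.const_add c).differentiableOn fun y hy => hy
  have hW : IsOpen (line ⁻¹' ((c + ·) ⁻¹' U)) := hV.preimage line.continuous
  have h0W : (0 : ℂ) ∈ line ⁻¹' ((c + ·) ⁻¹' U) := by rwa [mem_preimage, map_zero]
  have hcomp := line.iteratedFDerivWithin_comp_right
    (contDiffOn_of_differentiableOn_isOpen hV hdV n) hV.uniqueDiffOn hW.uniqueDiffOn h0W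
    (i := n) le_rfl
  rw [iteratedFDerivWithin_of_isOpen n hW h0W, map_zero, iteratedFDerivWithin_of_isOpen n hV hcV,
    iteratedFDeriv_comp_add_left, add_zero] at hcomp
  have hline : (fun t : ℂ => f (c + t • x)) = (fun y => f (c + y)) ∘ line := rfl
  rw [iteratedDeriv_eq_iteratedFDeriv, hline, hcomp]
  simp [line]

theorem add_smul_mem_ball {c x : E} {R s : ℝ} {t : ℂ} (ht : ‖t‖ ≤ R / s) (hx : ‖x‖ < s)
    (hR : 0 < R) : c + t • x ∈ ball c R := by
  have hs : 0 < s := (norm_nonneg x).trans_lt hx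
  rw [mem_ball_iff_norm, add_sub_cancel_left, norm_smul]
  calc ‖t‖ * ‖x‖ ≤ R / s * ‖x‖ := by gcongr
    _ < R / s * s := by gcongr
    _ = R := div_mul_cancel₀ R hs.ne'

theorem differentiableOn_comp_add_smul {f : E → F} {c x : E} {R s : ℝ}
    (hd : DifferentiableOn ℂ f (ball c R)) (hx : ‖x‖ < s) (hR : 0 < R) :
    DifferentiableOn ℂ (fun t : ℂ => f (c + t • x)) (closedBall 0 (R / s)) :=
  hd.comp ((differentiable_id.smul_const x).const_add c).differentiableOn
    fun _ ht => add_smul_mem_ball (mem_closedBall_zero_iff.1 ht) hx hR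

theorem norm_taylor_term_le [CompleteSpace F] {f : E → F} {c x : E} {R M s : ℝ} (hR : 0 < R)
    (hd : DifferentiableOn ℂ f (ball c R)) (hM : ∀ x ∈ ball c R, ‖f x‖ ≤ M) (hx : ‖x‖ < s)
    (n : ℕ) :
    ‖(n.factorial : ℂ)⁻¹ • iteratedFDeriv ℂ n f c (fun _ => x)‖ ≤ M * (s / R) ^ n := by
  have hs : 0 < s := (norm_nonneg x).trans_lt hx
  have hcauchy := Complex.norm_iteratedDeriv_le_of_forall_mem_sphere_norm_le n (div_pos hR hs)
    ((differentiableOn_comp_add_smul hd hx hR).mono closure_ball_subset_closedBall).diffContOnCl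
    fun t ht => hM _ (add_smul_mem_ball (mem_sphere_zero_iff_norm.1 ht).le hx hR)
  rw [iteratedDeriv_comp_add_smul isOpen_ball (mem_ball_self hR) hd] at hcauchy
  rw [norm_smul, norm_inv, Complex.norm_natCast, inv_mul_le_iff₀ (by positivity)]
  refine hcauchy.trans_eq ?_
  rw [← inv_div s R, inv_pow, div_inv_eq_mul, mul_assoc]

theorem hasSum_taylor [CompleteSpace F] {f : E → F} {c x : E} {R : ℝ}
    (hd : DifferentiableOn ℂ f (ball c R)) (hx : ‖x‖ < R) :
    HasSum (fun n : ℕ => (n.factorial : ℂ)⁻¹ • iteratedFDeriv ℂ n f c (fun _ => x))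
      (f (c + x)) := by
  obtain ⟨s, hxs, hsR⟩ := exists_between hx
  have hs : 0 < s := (norm_nonneg x).trans_lt hxs
  have hR : 0 < R := hs.trans hsR
  have hone : (1 : ℂ) ∈ ball (0 : ℂ) (R / s) := by simpa using (one_lt_div hs).2 hsR
  simpa [iteratedDeriv_comp_add_smul isOpen_ball (mem_ball_self hR) hd] using
    Complex.hasSum_taylorSeries_on_ball
      ((differentiableOn_comp_add_smul hd hxs hR).mono ball_subset_closedBall) hone

theorem norm_inv_factorial_smul_iteratedFDeriv_le [CompleteSpace F] {f : E → F} {c : E} {R M : ℝ}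
    (hR : 0 < R) (hd : DifferentiableOn ℂ f (ball c R)) (hM : ∀ x ∈ ball c R, ‖f x‖ ≤ M) (n : ℕ) :
    ‖(n.factorial : ℂ)⁻¹ • iteratedFDeriv ℂ n f c‖
      ≤ (2 * Real.exp 1 / R) ^ n * (Real.exp 1 * M) := by
  have hM0 : 0 ≤ M := (norm_nonneg _).trans (hM c (mem_ball_self hR))
  have hexp : ((n : ℝ) + 1) ^ n / n.factorial ≤ Real.exp 1 ^ n * Real.exp 1 := by
    rw [← pow_succ, ← Real.exp_nat_mul, mul_one, Nat.cast_succ]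
    exact Real.pow_div_factorial_le_exp _ (by positivity) n
  have hρ : n * (R / (n + 1)) < R := by
    rw [mul_div_left_comm]
    exact mul_lt_of_lt_one_right hR ((div_lt_one (by positivity)).2 (lt_add_one _))
  rw [norm_smul, norm_inv, Complex.norm_natCast]
  calc (n.factorial : ℝ)⁻¹ * ‖iteratedFDeriv ℂ n f c‖
      ≤ (n.factorial : ℝ)⁻¹ * ((2 / (R / (n + 1))) ^ n * M) := by
        gcongr
        exact norm_iteratedFDeriv_le_of_norm_le (by positivity) hρ hd hM
    _ = (2 / R) ^ n * M * (((n : ℝ) + 1) ^ n / n.factorial) := by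
        rw [div_div_eq_mul_div, div_pow, mul_pow, div_pow]; ring
    _ ≤ (2 / R) ^ n * M * (Real.exp 1 ^ n * Real.exp 1) := by gcongr
    _ = (2 * Real.exp 1 / R) ^ n * (Real.exp 1 * M) := by
        rw [div_pow, div_pow, mul_pow]; ring

theorem analyticAt_of_norm_le [CompleteSpace F] {f : E → F} {c : E} {R M : ℝ}
    (hR : 0 < R) (hd : DifferentiableOn ℂ f (ball c R)) (hM : ∀ x ∈ ball c R, ‖f x‖ ≤ M) :
    AnalyticAt ℂ f c := by
  let p : FormalMultilinearSeries ℂ E F := fun n => (n.factorial : ℂ)⁻¹ • iteratedFDeriv ℂ n f c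
  have he : 0 < Real.exp 1 := Real.exp_pos 1
  let r : NNReal := ⟨R / (2 * Real.exp 1), by positivity⟩
  have hr : 0 < r := div_pos hR (by positivity)
  have hrR : (r : ℝ) ≤ R := div_le_self hR.le (by linarith [Real.add_one_le_exp 1])
  have hradius : (r : ENNReal) ≤ p.radius := p.le_radius_of_bound (Real.exp 1 * M) fun n => by
    refine (mul_le_mul_of_nonneg_right (norm_inv_factorial_smul_iteratedFDeriv_le hR hd hM n)
      (by positivity)).trans_eq ?_
    rw [mul_right_comm, ← mul_pow, show (r : ℝ) = R / (2 * Real.exp 1) from rfl,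
      div_mul_div_cancel₀ hR.ne', div_self (by positivity), one_pow, one_mul]
  refine HasFPowerSeriesAt.analyticAt (p := p) ⟨r, hradius, by exact_mod_cast hr, fun {y} hy => ?_⟩
  rw [Metric.eball_coe, mem_ball_zero_iff] at hy
  exact hasSum_taylor hd (hy.trans_le hrR)

theorem analyticOnNhd_of_differentiableOn_isOpen [CompleteSpace F] {f : E → F} {U : Set E}
    (hU : IsOpen U) (hd : DifferentiableOn ℂ f U) : AnalyticOnNhd ℂ f U := fun x hx => by
  obtain ⟨R, M, hR, hRU, hM⟩ := exists_ball_norm_le_of_continuousOn hU hd.continuousOn hx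
  exact analyticAt_of_norm_le hR (hd.mono hRU) hM

end Holomorphic

section Goldstine

variable {X : Type*} [NormedAddCommGroup X] [NormedSpace ℂ X]

theorem mul_norm_le_of_re_le {l : StrongDual ℂ X} {r u : ℝ} (hr : 0 < r)
    (h : ∀ x ∈ closedBall (0 : X) r, (l x).re ≤ u) : r * ‖l‖ ≤ u := by
  have hball : ∀ x ∈ closedBall (0 : X) r, ‖l x‖ ≤ u := by
    intro x hx
    obtain ⟨c, hc, hcl⟩ := Complex.exists_norm_eq_mul_self (l x)
    have hcx := h (c • x) (by simpa [norm_smul, hc] using hx)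
    rwa [map_smul, smul_eq_mul, ← hcl, Complex.ofReal_re] at hcx
  rw [mul_comm, ← le_div_iff₀ hr]
  exact ContinuousLinearMap.opNorm_bound_of_ball_bound hr u l hball

theorem exists_filter_tendsto_of_re_le {E F ι : Type*} [AddCommGroup E] [Module ℂ E]
    [AddCommGroup F] [Module ℂ F] (B : E →ₗ[ℂ] F →ₗ[ℂ] ℂ) (T : ι → E) {s : Set ι}
    (hs : Convex ℝ (T '' s)) {z : E}
    (hz : ∀ (y : F) (u : ℝ), (∀ i ∈ s, (B (T i) y).re ≤ u) → (B z y).re ≤ u) :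
    ∃ G : Filter ι, G.NeBot ∧ s ∈ G ∧ ∀ y : F, Tendsto (fun i => B (T i) y) G (𝓝 (B z y)) := by
  let T' : ι → WeakBilin B := T
  let z' : WeakBilin B := z
  have : ContinuousSMul ℝ (WeakBilin B) := IsScalarTower.continuousSMul ℂ
  have hmem : z' ∈ closure (T' '' s) := by
    by_contra hz_notMem
    obtain ⟨g, u, hlt, hgt⟩ := RCLike.geometric_hahn_banach_closed_point (𝕜 := ℂ)
      (Convex.closure (E := WeakBilin B) hs) isClosed_closure hz_notMem
    obtain ⟨y, rfl⟩ := LinearMap.dualEmbedding_surjective B g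
    exact hgt.not_ge (hz y u fun i hi => (hlt _ (subset_closure (mem_image_of_mem T' hi))).le)
  refine ⟨comap T' (𝓝 z') ⊓ 𝓟 s, ?_, mem_inf_of_right (mem_principal_self s), fun y => ?_⟩
  · rw [← map_neBot_iff T', Filter.push_pull', map_principal]
    exact mem_closure_iff_clusterPt.1 hmem
  · exact (((WeakBilin.eval_continuous B y).tendsto z').comp tendsto_comap).mono_left inf_le_left

theorem exists_filter_tendsto_bidual (z : StrongDual ℂ (StrongDual ℂ X)) {r : ℝ} (hz : ‖z‖ < r) :
    ∃ F : Filter X, F.NeBot ∧ (∀ᶠ x in F, ‖x‖ ≤ r) ∧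
      ∀ l : StrongDual ℂ X, Tendsto l F (𝓝 (z l)) := by
  have hr : 0 < r := (norm_nonneg z).trans_lt hz
  have hconv : Convex ℝ (NormedSpace.inclusionInDoubleDual ℂ X '' closedBall 0 r) :=
    (convex_closedBall 0 r).is_linear_image
      ((NormedSpace.inclusionInDoubleDual ℂ X).restrictScalars ℝ).toLinearMap.isLinear
  obtain ⟨G, hG, hball, hlim⟩ := exists_filter_tendsto_of_re_le
    (ContinuousLinearMap.coeLM ℂ : StrongDual ℂ (StrongDual ℂ X) →ₗ[ℂ] StrongDual ℂ X →ₗ[ℂ] ℂ)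
    (NormedSpace.inclusionInDoubleDual ℂ X) hconv (z := z) fun l u h => calc
      (z l).re ≤ ‖z‖ * ‖l‖ := (Complex.re_le_norm _).trans (z.le_opNorm l)
      _ ≤ r * ‖l‖ := by gcongr
      _ ≤ u := mul_norm_le_of_re_le hr h
  exact ⟨G, hG, mem_of_superset hball fun x hx => mem_closedBall_zero_iff.1 hx, hlim⟩

end Goldstine

section IteratedFilter

variable {X : Type*}

/-- The iterated filter `F ⊗ ⋯ ⊗ F` on `m`-tuples: a property holds eventually if it holds
eventually in the first variable, eventually in the second variable, and so on. -/
def iterFilter (F : Filter X) : (m : ℕ) → Filter (Fin m → X)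
  | 0 => pure Fin.elim0
  | m + 1 => F.bind fun x => (iterFilter F m).map (Fin.cons x)

theorem eventually_iterFilter_succ {F : Filter X} {m : ℕ} {p : (Fin (m + 1) → X) → Prop} :
    (∀ᶠ v in iterFilter F (m + 1), p v) ↔
      ∀ᶠ x in F, ∀ᶠ v in iterFilter F m, p (Fin.cons x v) := by
  simp only [iterFilter, eventually_bind, eventually_map]

theorem neBot_bind {α β : Type*} {f : Filter α} [f.NeBot] {g : α → Filter β}
    (hg : ∀ a, (g a).NeBot) : (f.bind g).NeBot := by
  rw [neBot_iff, Ne, ← eventually_false_iff_eq_bot, eventually_bind]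
  simp only [eventually_const, not_false_eq_true]

instance iterFilter_neBot (F : Filter X) [F.NeBot] : ∀ m : ℕ, (iterFilter F m).NeBot
  | 0 => pure_neBot
  | m + 1 => have := iterFilter_neBot F m; neBot_bind fun _ => inferInstance

theorem eventually_iterFilter_forall {F : Filter X} {p : X → Prop} (h : ∀ᶠ x in F, p x) (m : ℕ) :
    ∀ᶠ v in iterFilter F m, ∀ i, p (v i) := by
  induction m with
  | zero => exact Eventually.of_forall fun v i => i.elim0
  | succ m ih =>
    rw [eventually_iterFilter_succ]
    filter_upwards [h] with x hx
    filter_upwards [ih] with v hv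
    exact Fin.cases hx hv

theorem exists_succ_comp_of_strictMono {m n : ℕ} {i : Fin n → Fin (m + 1)} (hi : StrictMono i)
    (h0 : ∀ k, i k ≠ 0) : ∃ j : Fin n → Fin m, StrictMono j ∧ i = Fin.succ ∘ j :=
  ⟨fun k => (i k).pred (h0 k), fun _ _ hab => Fin.pred_lt_pred_iff.2 (hi hab),
    funext fun k => (Fin.succ_pred (i k) (h0 k)).symm⟩

theorem tendsto_comp_iterFilter (F : Filter X) {m n : ℕ} {i : Fin n → Fin m} (hi : StrictMono i) :
    Tendsto (fun v => v ∘ i) (iterFilter F m) (iterFilter F n) := by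
  suffices ∀ p : (Fin n → X) → Prop, (∀ᶠ w in iterFilter F n, p w) →
      ∀ᶠ v in iterFilter F m, p (v ∘ i) from fun s hs => this (· ∈ s) hs
  induction m generalizing n with
  | zero =>
    obtain _ | n := n
    · exact fun p hp => hp.mono fun w hw => by rwa [Subsingleton.elim (w ∘ i) w]
    · exact (i 0).elim0
  | succ m ih =>
    intro p hp
    rw [eventually_iterFilter_succ]
    by_cases h0 : ∀ k, i k ≠ 0
    · obtain ⟨j, hj, rfl⟩ := exists_succ_comp_of_strictMono hi h0
      exact Eventually.of_forall fun _ => ih hj p hp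
    · push Not at h0
      obtain ⟨k₀, hk₀⟩ := h0
      obtain _ | n := n
      · exact k₀.elim0
      have hi0 : i 0 = 0 := Fin.le_zero_iff.1 (hk₀ ▸ hi.monotone (Fin.zero_le k₀))
      obtain ⟨j, hj, hij⟩ := exists_succ_comp_of_strictMono (i := i ∘ Fin.succ)
        (hi.comp (Fin.strictMono_succ)) fun k => hi0 ▸ (hi (Fin.succ_pos k)).ne'
      filter_upwards [eventually_iterFilter_succ.1 hp] with x hx
      filter_upwards [ih hj _ hx] with v hv
      convert hv using 1
      ext k
      refine Fin.cases ?_ (fun k => ?_) k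
      · simp [hi0]
      · simpa using congrArg (Fin.cons x v : Fin (m + 1) → X) (congrFun hij k)

end IteratedFilter

section DavieGamelin

variable {X : Type*} [NormedAddCommGroup X] [NormedSpace ℂ X]

theorem tendsto_iterFilter_aronBerner {F : Filter X} {z : StrongDual ℂ (StrongDual ℂ X)}
    (hF : ∀ l : StrongDual ℂ X, Tendsto l F (𝓝 (z l))) {n : ℕ}
    (A : ContinuousMultilinearMap ℂ (fun _ : Fin n => X) ℂ) :
    Tendsto A (iterFilter F n) (𝓝 (aronBerner n (fun _ => z) A)) := by
  rw [Metric.tendsto_nhds]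
  induction n with
  | zero =>
    refine fun ε hε => Eventually.of_forall fun v => ?_
    rw [Subsingleton.elim v 0]
    exact (dist_self (A 0)).trans_lt hε
  | succ n ih =>
    intro ε hε
    rw [eventually_iterFilter_succ]
    filter_upwards [Metric.tendsto_nhds.1 (hF ((aronBerner n (fun _ => z)).comp A.curryLeft))
      (ε / 2) (half_pos hε)] with x hx
    filter_upwards [ih (A.curryLeft x) (ε / 2) (half_pos hε)] with v hv
    calc dist (A.curryLeft x v) (z ((aronBerner n (fun _ => z)).comp A.curryLeft))
        ≤ _ := dist_triangle _ (aronBerner n (fun _ => z) (A.curryLeft x)) _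
      _ < ε / 2 + ε / 2 := add_lt_add hv hx
      _ = ε := add_halves ε

/-- Symmetry allows sorting the selected variables, so that they are in the order in which the
limits defining `aronBerner` are taken. -/
theorem tendsto_comp_iterFilter_aronBerner {F : Filter X} {z : StrongDual ℂ (StrongDual ℂ X)}
    (hF : ∀ l : StrongDual ℂ X, Tendsto l F (𝓝 (z l))) {m n : ℕ}
    {A : ContinuousMultilinearMap ℂ (fun _ : Fin n => X) ℂ}
    (hA : ∀ (v : Fin n → X) (σ : Equiv.Perm (Fin n)), A (v ∘ σ) = A v) {i : Fin n → Fin m}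
    (hi : Function.Injective i) :
    Tendsto (fun v => A (v ∘ i)) (iterFilter F m) (𝓝 (aronBerner n (fun _ => z) A)) := by
  have hmono : StrictMono (i ∘ Tuple.sort i) :=
    (Tuple.monotone_sort i).strictMono_of_injective (hi.comp (Equiv.injective _))
  refine ((tendsto_iterFilter_aronBerner hF A).comp (tendsto_comp_iterFilter F hmono)).congr
    fun v => ?_
  rw [Function.comp_apply, ← Function.comp_assoc, hA]

/-- The arithmetic mean of a tuple; its value at the empty tuple is `0`. -/
def mean {m : ℕ} (v : Fin m → X) : X := (m : ℂ)⁻¹ • ∑ j, v j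

theorem norm_mean_le {m : ℕ} {v : Fin m → X} {r : ℝ} (hr : 0 ≤ r) (hv : ∀ i, ‖v i‖ ≤ r) :
    ‖mean v‖ ≤ r := by
  rw [mean, norm_smul, norm_inv, Complex.norm_natCast]
  obtain rfl | hm := Nat.eq_zero_or_pos m
  · simpa using hr
  · rw [inv_mul_le_iff₀ (by exact_mod_cast hm)]
    simpa using norm_sum_le_of_le Finset.univ fun i _ => hv i

theorem map_mean {m n : ℕ} (A : ContinuousMultilinearMap ℂ (fun _ : Fin n => X) ℂ)
    (v : Fin m → X) :
    A (fun _ => mean v) = ((m : ℂ) ^ n)⁻¹ * ∑ i : Fin n → Fin m, A (v ∘ i) := by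
  unfold mean
  rw [A.map_smul_univ (fun _ => (m : ℂ)⁻¹) (fun _ => ∑ j, v j), A.map_sum (fun _ j => v j)]
  simp [Function.comp_def]

theorem card_filter_injective (m n : ℕ) :
    (Finset.univ.filter fun i : Fin n → Fin m => Function.Injective i).card
      = m.descFactorial n := by
  rw [← Fintype.card_subtype, Fintype.card_congr (Equiv.subtypeInjectiveEquivEmbedding _ _),
    Fintype.card_embedding_eq, Fintype.card_fin, Fintype.card_fin]

theorem tendsto_descFactorial_div_pow (n : ℕ) :
    Tendsto (fun m : ℕ => (m.descFactorial n : ℝ) / (m : ℝ) ^ n) atTop (𝓝 1) := by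
  refine (isEquivalent_iff_tendsto_one ?_).1 (isEquivalent_descFactorial n)
  filter_upwards [eventually_gt_atTop 0] with m hm
  positivity

/-- In the expansion of `A(x, …, x)` at the mean `x` of `m` vectors, the terms with repeated
vectors form the proportion `1 - m.descFactorial n / m ^ n` of all terms. -/
theorem dist_map_mean_le {m n : ℕ} (hm : 0 < m)
    (A : ContinuousMultilinearMap ℂ (fun _ : Fin n => X) ℂ) {v : Fin m → X} {L : ℂ} {ε C : ℝ}
    (hinj : ∀ i : Fin n → Fin m, Function.Injective i → dist (A (v ∘ i)) L ≤ ε)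
    (hall : ∀ i : Fin n → Fin m, dist (A (v ∘ i)) L ≤ C) (hε : 0 ≤ ε) :
    dist (A fun _ => mean v) L ≤ ε + (1 - (m.descFactorial n : ℝ) / (m : ℝ) ^ n) * C := by
  classical
  have hm' : (0 : ℝ) < (m : ℝ) ^ n := by positivity
  have hmC : (m : ℂ) ^ n ≠ 0 := pow_ne_zero n (by exact_mod_cast hm.ne')
  have hexpand : (A fun _ => mean v) - L =
      ((m : ℂ) ^ n)⁻¹ * ∑ i : Fin n → Fin m, (A (v ∘ i) - L) := by
    rw [Finset.sum_sub_distrib, mul_sub, ← map_mean]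
    simp [hmC]
  have hterm : ∀ i : Fin n → Fin m, ‖A (v ∘ i) - L‖ ≤
      ε + (C - if Function.Injective i then C else 0) := by
    intro i
    rw [← dist_eq_norm]
    split_ifs with h
    · simpa using hinj i h
    · linarith [hall i]
  rw [dist_eq_norm, hexpand, norm_mul, norm_inv, norm_pow, Complex.norm_natCast,
    inv_mul_le_iff₀ hm']
  refine (norm_sum_le_of_le _ fun i _ => hterm i).trans_eq ?_
  rw [Finset.sum_add_distrib, Finset.sum_sub_distrib, ← Finset.sum_filter, Finset.sum_const,
    Finset.sum_const, Finset.sum_const, card_filter_injective]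
  simp only [Finset.card_univ, Fintype.card_fun, Fintype.card_fin, nsmul_eq_mul, Nat.cast_pow]
  field_simp

/-- The filter of means of generic `m`-tuples for `F`, as `m → ∞`. -/
def meanFilter (F : Filter X) : Filter X :=
  atTop.bind fun m : ℕ => (iterFilter F m).map mean

instance meanFilter_neBot (F : Filter X) [F.NeBot] : (meanFilter F).NeBot :=
  neBot_bind fun _ => inferInstance

theorem eventually_meanFilter {F : Filter X} {p : X → Prop} :
    (∀ᶠ x in meanFilter F, p x) ↔ ∀ᶠ m in atTop, ∀ᶠ v in iterFilter F m, p (mean v) := by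
  simp only [meanFilter, eventually_bind, eventually_map]

theorem eventually_meanFilter_norm_le {F : Filter X} {r : ℝ} (hr : 0 ≤ r)
    (hF : ∀ᶠ x in F, ‖x‖ ≤ r) : ∀ᶠ x in meanFilter F, ‖x‖ ≤ r :=
  eventually_meanFilter.2 <| Eventually.of_forall fun m =>
    (eventually_iterFilter_forall hF m).mono fun _ => norm_mean_le hr

theorem dist_map_le_of_norm_le {n : ℕ} (A : ContinuousMultilinearMap ℂ (fun _ : Fin n => X) ℂ)
    {w : Fin n → X} {r : ℝ} (hw : ∀ k, ‖w k‖ ≤ r) (L : ℂ) : dist (A w) L ≤ ‖A‖ * r ^ n + ‖L‖ := by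
  refine (dist_le_norm_add_norm _ _).trans (add_le_add_left ((A.le_opNorm w).trans ?_) _)
  gcongr
  simpa using Finset.prod_le_prod (fun k _ => norm_nonneg (w k)) fun k (_ : k ∈ Finset.univ) => hw k

theorem tendsto_meanFilter_aronBerner {F : Filter X} {z : StrongDual ℂ (StrongDual ℂ X)}
    (hF : ∀ l : StrongDual ℂ X, Tendsto l F (𝓝 (z l))) {r : ℝ} (hr : ∀ᶠ x in F, ‖x‖ ≤ r) {n : ℕ}
    {A : ContinuousMultilinearMap ℂ (fun _ : Fin n => X) ℂ}
    (hA : ∀ (v : Fin n → X) (σ : Equiv.Perm (Fin n)), A (v ∘ σ) = A v) :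
    Tendsto (fun x => A fun _ => x) (meanFilter F) (𝓝 (aronBerner n (fun _ => z) A)) := by
  rw [Metric.tendsto_nhds]
  intro ε hε
  rw [eventually_meanFilter]
  set L := aronBerner n (fun _ => z) A
  set C : ℝ := ‖A‖ * r ^ n + ‖L‖
  have hlim : Tendsto (fun m : ℕ => ε / 2 + (1 - (m.descFactorial n : ℝ) / (m : ℝ) ^ n) * C)
      atTop (𝓝 (ε / 2 + (1 - 1) * C)) :=
    tendsto_const_nhds.add ((tendsto_const_nhds.sub (tendsto_descFactorial_div_pow n)).mul_const C)
  have hlt : ε / 2 + (1 - 1) * C < ε := by linarith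
  filter_upwards [hlim.eventually_lt_const hlt, eventually_gt_atTop 0] with m hmε hm
  have hinj : ∀ᶠ v in iterFilter F m, ∀ i : Fin n → Fin m, Function.Injective i →
      dist (A (v ∘ i)) L < ε / 2 :=
    eventually_all.2 fun i => eventually_imp_distrib_left.2 fun hi =>
      Metric.tendsto_nhds.1 (tendsto_comp_iterFilter_aronBerner hF hA hi) _ (half_pos hε)
  filter_upwards [hinj, eventually_iterFilter_forall hr m] with v hv hvr
  exact (dist_map_mean_le hm A (fun i hi => (hv i hi).le)
    (fun i => dist_map_le_of_norm_le A (fun k => hvr _) L) (half_pos hε).le).trans_lt hmε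

theorem exists_filter_tendsto_aronBerner (z : StrongDual ℂ (StrongDual ℂ X)) {r : ℝ}
    (hz : ‖z‖ < r) :
    ∃ G : Filter X, G.NeBot ∧ (∀ᶠ x in G, ‖x‖ ≤ r) ∧
      ∀ (n : ℕ) (A : ContinuousMultilinearMap ℂ (fun _ : Fin n => X) ℂ),
        (∀ (v : Fin n → X) (σ : Equiv.Perm (Fin n)), A (v ∘ σ) = A v) →
          Tendsto (fun x => A fun _ => x) G (𝓝 (aronBerner n (fun _ => z) A)) := by
  obtain ⟨F, hF_neBot, hFr, hF⟩ := exists_filter_tendsto_bidual z hz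
  exact ⟨meanFilter F, inferInstance,
    eventually_meanFilter_norm_le ((norm_nonneg z).trans hz.le) hFr,
    fun n A hA => tendsto_meanFilter_aronBerner hF hFr hA⟩

end DavieGamelin

section SchwarzPick

theorem norm_one_sub_conj_mul_sq_sub_norm_sub_sq (a w : ℂ) :
    ‖1 - (starRingEnd ℂ) a * w‖ ^ 2 - ‖w - a‖ ^ 2 = (1 - ‖a‖ ^ 2) * (1 - ‖w‖ ^ 2) := by
  simp only [Complex.sq_norm, Complex.normSq_apply, Complex.sub_re, Complex.sub_im, Complex.mul_re,
    Complex.mul_im, Complex.conj_re, Complex.conj_im, Complex.one_re, Complex.one_im]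
  ring

theorem norm_sub_le_norm_one_sub_conj_mul {a w : ℂ} (ha : ‖a‖ ≤ 1) (hw : ‖w‖ ≤ 1) :
    ‖w - a‖ ≤ ‖1 - (starRingEnd ℂ) a * w‖ := by
  refine le_of_sq_le_sq (sub_nonneg.1 ?_) (norm_nonneg _)
  rw [norm_one_sub_conj_mul_sq_sub_norm_sub_sq]
  exact mul_nonneg (sub_nonneg.2 (pow_le_one₀ (norm_nonneg a) ha))
    (sub_nonneg.2 (pow_le_one₀ (norm_nonneg w) hw))

theorem one_sub_conj_mul_ne_zero {a w : ℂ} (ha : ‖a‖ < 1) (hw : ‖w‖ ≤ 1) :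
    1 - (starRingEnd ℂ) a * w ≠ 0 := by
  refine sub_ne_zero.2 fun h => ?_
  have hlt : ‖(starRingEnd ℂ) a * w‖ < 1 := by
    rw [norm_mul, RCLike.norm_conj]
    exact mul_lt_one_of_nonneg_of_lt_one_left (norm_nonneg a) ha hw
  exact hlt.ne (by rw [← h, norm_one])

variable {E : Type*} [NormedAddCommGroup E] [NormedSpace ℂ E]

theorem norm_sub_le_norm_mul_norm_one_sub_conj_mul {f : E → ℂ}
    (hd : DifferentiableOn ℂ f (ball 0 1)) (hf : ∀ x ∈ ball (0 : E) 1, ‖f x‖ ≤ 1) {x : E}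
    (hx : x ∈ ball (0 : E) 1) :
    ‖f x - f 0‖ ≤ ‖x‖ * ‖1 - (starRingEnd ℂ) (f 0) * f x‖ := by
  have h0 : (0 : E) ∈ ball (0 : E) 1 := mem_ball_self one_pos
  obtain hf0 | hf0 := (hf 0 h0).eq_or_lt
  · have hconst : f x = f 0 := Complex.eqOn_of_isPreconnected_of_isMaxOn_norm
      (convex_ball 0 1).isPreconnected isOpen_ball hd h0
      (fun y hy => (hf y hy).trans_eq hf0.symm) hx
    rw [hconst, sub_self, norm_zero]
    positivity
  have hne : ∀ y ∈ ball (0 : E) 1, 1 - (starRingEnd ℂ) (f 0) * f y ≠ 0 := fun y hy =>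
    one_sub_conj_mul_ne_zero hf0 (hf y hy)
  have hgd : DifferentiableOn ℂ (fun y => (f y - f 0) / (1 - (starRingEnd ℂ) (f 0) * f y))
      (ball 0 1) :=
    ((hd.sub_const (f 0)).mul (((hd.const_mul _).const_sub 1).inv hne)).congr
      fun _ _ => div_eq_mul_inv _ _
  have hmaps : MapsTo (fun y => (f y - f 0) / (1 - (starRingEnd ℂ) (f 0) * f y))
      (ball 0 1) (closedBall 0 1) := by
    intro y hy
    rw [mem_closedBall_zero_iff, norm_div]
    exact div_le_one_of_le₀ (norm_sub_le_norm_one_sub_conj_mul hf0.le (hf y hy)) (norm_nonneg _)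
  have hschwarz := Complex.norm_le_norm_of_mapsTo_ball hgd hmaps (by simp) (mem_ball_zero_iff.1 hx)
  rwa [norm_div, div_le_iff₀ (norm_pos_iff.2 (hne x hx))] at hschwarz

end SchwarzPick

section Characters

/-- Evaluation at a point, as a character of the algebra of bounded continuous functions. -/
def evalCharacter {S : Type*} [TopologicalSpace S] (y : S) :
    WeakDual.characterSpace ℂ (BoundedContinuousFunction S ℂ) :=
  ⟨StrongDual.toWeakDual (BoundedContinuousFunction.evalCLM ℂ y),
    fun h => one_ne_zero (α := ℂ)
      (DFunLike.congr_fun h (1 : BoundedContinuousFunction S ℂ)), fun _ _ => rfl⟩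

/-- The restriction of a character to a subalgebra, which need not be closed. -/
def restrictCharacter {A : Type*} [NormedRing A] [NormedAlgebra ℂ A] (𝒜 : Subalgebra ℂ A)
    (φ : WeakDual.characterSpace ℂ A) : WeakDual.characterSpace ℂ 𝒜 :=
  ⟨StrongDual.toWeakDual
      ((WeakDual.toStrongDual (φ : WeakDual ℂ A)).comp (Subalgebra.toSubmodule 𝒜).subtypeL),
    fun h => one_ne_zero (α := ℂ) ((map_one φ).symm.trans (DFunLike.congr_fun h (1 : 𝒜))),
    fun f g => map_mul φ (f : A) g⟩

theorem exists_character_tendsto {S : Type*} [TopologicalSpace S] (U : Ultrafilter S) :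
    ∃ Φ : WeakDual.characterSpace ℂ (BoundedContinuousFunction S ℂ),
      ∀ f : BoundedContinuousFunction S ℂ, Tendsto f U (𝓝 (Φ f)) := by
  refine ⟨(U.map evalCharacter).lim, fun f => ?_⟩
  have hcont : Continuous
      fun Φ : WeakDual.characterSpace ℂ (BoundedContinuousFunction S ℂ) => Φ f :=
    (WeakDual.eval_continuous f).comp continuous_subtype_val
  exact (hcont.tendsto _).comp (U.map evalCharacter).le_nhds_lim

variable {X : Type*} [NormedAddCommGroup X] [NormedSpace ℂ X] {𝒜 : Subalgebra ℂ (BallFun X)}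

theorem zeroExt_zero_eq_deltaZero (f : 𝒜) : zeroExt (f : BallFun X) 0 = deltaZero 𝒜 f :=
  zeroExt_of_mem _ (mem_ball_self one_pos)

theorem norm_zeroExt_le (f : BallFun X) (x : X) : ‖zeroExt f x‖ ≤ ‖f‖ := by
  unfold zeroExt
  split_ifs with hx
  · exact f.norm_coe_le_norm _
  · simp

theorem norm_zeroExt_sub_zeroExt_zero_le (h𝒜 : 𝒜 ≤ Hinf X) {f : 𝒜} (hf : ‖f‖ ≤ 1) {x : X}
    (hx : x ∈ ball (0 : X) 1) :
    ‖zeroExt (f : BallFun X) x - deltaZero 𝒜 f‖ ≤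
      ‖x‖ * ‖1 - (starRingEnd ℂ) (deltaZero 𝒜 f) * zeroExt (f : BallFun X) x‖ := by
  rw [← zeroExt_zero_eq_deltaZero]
  exact norm_sub_le_norm_mul_norm_one_sub_conj_mul (h𝒜 f.2)
    (fun y _ => (norm_zeroExt_le _ y).trans hf) hx

theorem mem_gleasonPart_deltaZero_of_tendsto (h𝒜 : 𝒜 ≤ Hinf X) {G : Filter X} [G.NeBot] {r : ℝ}
    (hr : r < 1) (hG : ∀ᶠ x in G, ‖x‖ ≤ r) {φ : WeakDual.characterSpace ℂ 𝒜}
    (hφ : ∀ f : 𝒜, Tendsto (zeroExt (f : BallFun X)) G (𝓝 (φ f))) :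
    φ ∈ gleasonPart (deltaZero 𝒜) := by
  obtain ⟨x, hx⟩ := hG.exists
  refine (Real.sSup_le ?_ ((norm_nonneg x).trans hx)).trans_lt hr
  rintro _ ⟨f, hf_norm, hφf, rfl⟩
  have hpick : ∀ᶠ x in G, ‖zeroExt (f : BallFun X) x - deltaZero 𝒜 f‖ ≤
      r * ‖1 - (starRingEnd ℂ) (deltaZero 𝒜 f) * zeroExt (f : BallFun X) x‖ := by
    filter_upwards [hG] with x hxr
    refine (norm_zeroExt_sub_zeroExt_zero_le h𝒜 hf_norm
      (mem_ball_zero_iff.2 (hxr.trans_lt hr))).trans ?_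
    gcongr
  have hlim := le_of_tendsto_of_tendsto ((hφ f).sub_const _).norm
    ((((hφ f).const_mul _).const_sub 1).norm.const_mul r) hpick
  simpa [hφf] using hlim

theorem exists_mem_gleasonPart_tendsto (h𝒜 : 𝒜 ≤ Hinf X) (G : Ultrafilter X) {r : ℝ}
    (hr : r < 1) (hG : ∀ᶠ x in (G : Filter X), ‖x‖ ≤ r) :
    ∃ φ ∈ gleasonPart (deltaZero 𝒜),
      ∀ f : 𝒜, Tendsto (zeroExt (f : BallFun X)) G (𝓝 (φ f)) := by
  have hrange : range ((↑) : ball (0 : X) 1 → X) ∈ (G : Filter X) := by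
    filter_upwards [hG] with x hx
    exact ⟨⟨x, mem_ball_zero_iff.2 (hx.trans_lt hr)⟩, rfl⟩
  obtain ⟨Φ, hΦ⟩ := exists_character_tendsto (G.comap Subtype.val_injective hrange)
  have hlim : ∀ f : 𝒜, Tendsto (zeroExt (f : BallFun X)) G (𝓝 (restrictCharacter 𝒜 Φ f)) := by
    intro f
    rw [← map_comap_of_mem hrange, tendsto_map'_iff, ← G.coe_comap Subtype.val_injective hrange]
    exact (hΦ f).congr fun y => (zeroExt_of_mem _ y.2).symm
  exact ⟨_, mem_gleasonPart_deltaZero_of_tendsto h𝒜 hr hG hlim, hlim⟩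

end Characters

section Delta

variable {X : Type*} [NormedAddCommGroup X] [NormedSpace ℂ X]

theorem tendsto_zeroExt_canonicalExt {f : BallFun X} (hf : f ∈ Hinf X)
    {z : StrongDual ℂ (StrongDual ℂ X)} {G : Filter X} {r : ℝ} (hr : r < 1)
    (hG : ∀ᶠ x in G, ‖x‖ ≤ r)
    (hlim : ∀ (n : ℕ) (A : ContinuousMultilinearMap ℂ (fun _ : Fin n => X) ℂ),
      (∀ (v : Fin n → X) (σ : Equiv.Perm (Fin n)), A (v ∘ σ) = A v) →
        Tendsto (fun x => A fun _ => x) G (𝓝 (aronBerner n (fun _ => z) A))) :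
    Tendsto (zeroExt f) G (𝓝 (canonicalExt f z)) := by
  obtain ⟨s, hs, hs1⟩ : ∃ s, max r 0 < s ∧ s < 1 := exists_between (max_lt hr one_pos)
  obtain ⟨hrs, hs0⟩ := max_lt_iff.1 hs
  have hsymm : ∀ n (v : Fin n → X) (σ : Equiv.Perm (Fin n)),
      iteratedFDeriv ℂ n (zeroExt f) 0 (v ∘ σ) = iteratedFDeriv ℂ n (zeroExt f) 0 v := fun n v σ =>
    (analyticOnNhd_of_differentiableOn_isOpen isOpen_ball hf 0
      (mem_ball_self one_pos)).contDiffAt.iteratedFDeriv_comp_perm v σ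
  have htaylor : Tendsto (fun x => ∑' n : ℕ, (n.factorial : ℂ)⁻¹ *
      iteratedFDeriv ℂ n (zeroExt f) 0 (fun _ => x)) G (𝓝 (canonicalExt f z)) := by
    refine tendsto_tsum_of_dominated_convergence (bound := fun n => ‖f‖ * s ^ n)
      ((summable_geometric_of_lt_one hs0.le hs1).mul_left _)
      (fun n => (hlim n _ (hsymm n)).const_mul _) ?_
    filter_upwards [hG] with x hx n
    simpa using norm_taylor_term_le one_pos hf (fun y _ => norm_zeroExt_le f y)
      (hx.trans_lt hrs) n
  refine htaylor.congr' ?_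
  filter_upwards [hG] with x hx
  simpa using (hasSum_taylor hf (hx.trans_lt hr)).tsum_eq

theorem aronBerner_one_ofSubsingleton (z : StrongDual ℂ (StrongDual ℂ X)) (l : StrongDual ℂ X) :
    aronBerner 1 (fun _ => z) (ContinuousMultilinearMap.ofSubsingleton ℂ X ℂ (0 : Fin 1) l)
      = z l :=
  rfl

theorem exists_filter_tendsto_canonicalExt {z : StrongDual ℂ (StrongDual ℂ X)} (hz : ‖z‖ < 1) :
    ∃ r < 1, ∃ G : Filter X, G.NeBot ∧ (∀ᶠ x in G, ‖x‖ ≤ r) ∧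
      (∀ l : StrongDual ℂ X, Tendsto l G (𝓝 (z l))) ∧
      ∀ f ∈ Hinf X, Tendsto (zeroExt f) G (𝓝 (canonicalExt f z)) := by
  obtain ⟨r, hzr, hr⟩ := exists_between hz
  obtain ⟨G, hG_neBot, hG, hlim⟩ := exists_filter_tendsto_aronBerner z hzr
  refine ⟨r, hr, G, hG_neBot, hG, fun l => ?_, fun f hf =>
    tendsto_zeroExt_canonicalExt hf hr hG hlim⟩
  rw [← aronBerner_one_ofSubsingleton z l]
  exact hlim 1 _ fun v σ => by rw [Subsingleton.elim σ 1, Equiv.Perm.coe_one, Function.comp_id]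

theorem zeroExt_dualRestrict {x : X} (hx : x ∈ ball (0 : X) 1) (l : StrongDual ℂ X) :
    zeroExt (dualRestrict l) x = l x :=
  zeroExt_of_mem _ hx

theorem canonicalExt_dualRestrict {z : StrongDual ℂ (StrongDual ℂ X)} (hz : ‖z‖ < 1)
    (l : StrongDual ℂ X) : canonicalExt (dualRestrict l) z = z l := by
  obtain ⟨r, hr, G, hG_neBot, hG, hl, hf⟩ := exists_filter_tendsto_canonicalExt hz
  refine tendsto_nhds_unique ((hf _ (dualRestrict_mem_Au l).1).congr' ?_) (hl l)
  filter_upwards [hG] with x hx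
  exact zeroExt_dualRestrict (mem_ball_zero_iff.2 (hx.trans_lt hr)) l

theorem canonicalExt_zero (f : BallFun X) : canonicalExt f 0 = zeroExt f 0 := by
  rw [canonicalExt, tsum_eq_single 0]
  · change ((Nat.factorial 0 : ℕ) : ℂ)⁻¹ * iteratedFDeriv ℂ 0 (zeroExt f) 0 0 = _
    simp
  · intro n hn
    obtain ⟨n, rfl⟩ := Nat.exists_eq_succ_of_ne_zero hn
    simp [aronBerner_succ_apply]

variable {𝒜 : Subalgebra ℂ (BallFun X)}

theorem delta_dualIncl (h𝒜 : Au X ≤ 𝒜) {z : StrongDual ℂ (StrongDual ℂ X)}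
    (hz : ‖z‖ < 1) (l : StrongDual ℂ X) :
    delta 𝒜 z (dualIncl 𝒜 h𝒜 l) = z l :=
  canonicalExt_dualRestrict hz l

theorem delta_zero (f : 𝒜) : delta 𝒜 0 f = deltaZero 𝒜 f :=
  (canonicalExt_zero _).trans (zeroExt_zero_eq_deltaZero f)

theorem norm_lt_one_of_mem_ball {z : StrongDual ℂ (StrongDual ℂ X)} (hz : z ∈ ball 0 1) :
    ‖z‖ < 1 :=
  (dist_zero_right z).symm.trans_lt hz

theorem injOn_delta (h𝒜 : Au X ≤ 𝒜) : InjOn (delta 𝒜) (ball 0 1) := fun z hz w hw hzw => by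
  ext l
  rw [← delta_dualIncl h𝒜 (norm_lt_one_of_mem_ball hz), hzw,
    delta_dualIncl h𝒜 (norm_lt_one_of_mem_ball hw)]

theorem exists_mem_gleasonPart_eq_delta (h𝒜 : 𝒜 ≤ Hinf X) {z : StrongDual ℂ (StrongDual ℂ X)}
    (hz : ‖z‖ < 1) :
    ∃ φ ∈ gleasonPart (deltaZero 𝒜), ∀ f, φ f = delta 𝒜 z f := by
  obtain ⟨r, hr, G, hG_neBot, hG, -, hlim⟩ :=
    exists_filter_tendsto_canonicalExt hz
  have hle : (Ultrafilter.of G : Filter X) ≤ G := Ultrafilter.of_le G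
  obtain ⟨φ, hφ, hφlim⟩ := exists_mem_gleasonPart_tendsto h𝒜 (Ultrafilter.of G) hr (hle hG)
  exact ⟨φ, hφ, fun f => tendsto_nhds_unique (hφlim f) ((hlim f (h𝒜 f.2)).mono_left hle)⟩

theorem eq_deltaZero_of_mem_fiber_zero (h𝒜 : Au X ≤ 𝒜) {φ : WeakDual.characterSpace ℂ 𝒜}
    (hφ : φ ∈ fiber 𝒜 h𝒜 0) {z : StrongDual ℂ (StrongDual ℂ X)}
    (hz : ‖z‖ < 1) (hφz : ∀ f, φ f = delta 𝒜 z f) :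
    φ = deltaZero 𝒜 := by
  obtain rfl : z = 0 := by
    ext l
    rw [← delta_dualIncl h𝒜 hz, ← hφz]
    exact DFunLike.congr_fun (show projBidual 𝒜 h𝒜 φ = 0 from hφ) l
  ext f
  exact (hφz f).trans (delta_zero f)

end Delta

section Fiber

variable {X : Type*} [NormedAddCommGroup X] [NormedSpace ℂ X]

/-- An entire function of bounded type: it is holomorphic on the whole space and bounded on bounded
sets. -/
def IsEntireOfBoundedType (f : X → ℂ) : Prop :=
  Differentiable ℂ f ∧ ∀ r : ℝ, ∃ C : ℝ, ∀ x ∈ ball (0 : X) r, ‖f x‖ ≤ C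

theorem IsContinuousPolynomial.isEntireOfBoundedType {P : X → ℂ} (hP : IsContinuousPolynomial P) :
    IsEntireOfBoundedType P := by
  obtain ⟨N, A, hA⟩ := hP
  obtain rfl : P = fun x => ∑ k ∈ Finset.range (N + 1), A k fun _ => x := funext hA
  refine ⟨Differentiable.fun_sum fun k _ => ?_, fun r =>
    ⟨∑ k ∈ Finset.range (N + 1), ‖A k‖ * r ^ k, fun x hx => norm_sum_le_of_le _ fun k _ => ?_⟩⟩
  · exact ((A k).contDiff.differentiable one_ne_zero).comp
      (differentiable_pi.2 fun _ => differentiable_id)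
  · exact (A k).le_opNorm_mul_pow_of_le ((pi_norm_const_le x).trans (mem_ball_zero_iff.1 hx).le)

theorem IsEntireOfBoundedType.comp_add_smul {f : X → ℂ} (hf : IsEntireOfBoundedType f) (c : X)
    (a : ℂ) : IsEntireOfBoundedType fun x => f (c + a • x) := by
  refine ⟨hf.1.comp ((differentiable_id.const_smul a).const_add c), fun r => ?_⟩
  obtain ⟨C, hC⟩ := hf.2 (‖c‖ + ‖a‖ * r + 1)
  refine ⟨C, fun x hx => hC _ (mem_ball_zero_iff.2 ?_)⟩
  calc ‖c + a • x‖ ≤ ‖c‖ + ‖a • x‖ := norm_add_le _ _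
    _ = ‖c‖ + ‖a‖ * ‖x‖ := by rw [norm_smul]
    _ ≤ ‖c‖ + ‖a‖ * r := by gcongr; exact (mem_ball_zero_iff.1 hx).le
    _ < ‖c‖ + ‖a‖ * r + 1 := lt_add_one _

theorem exists_mem_Au_eq {f : X → ℂ} {R M : ℝ} (hR : 1 < R)
    (hd : DifferentiableOn ℂ f (ball 0 R)) (hM : ∀ x ∈ ball (0 : X) R, ‖f x‖ ≤ M) :
    ∃ g ∈ Au X, ∀ x ∈ ball (0 : X) 1, zeroExt g x = f x := by
  have hsub : ball (0 : X) 1 ⊆ ball 0 R := ball_subset_ball hR.le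
  have hlip : LipschitzWith (2 * M / (R - 1)).toNNReal fun y : ball (0 : X) 1 => f y :=
    LipschitzWith.of_dist_le' fun y y' => by
      simpa only [Subtype.dist_eq, dist_eq_norm] using
        norm_image_sub_le_of_norm_le hR hd hM y'.2 y.2
  let g : BallFun X := BoundedContinuousFunction.ofNormedAddCommGroup
    (fun y : ball (0 : X) 1 => f y) hlip.continuous M fun y => hM y (hsub y.2)
  have hg : ∀ x ∈ ball (0 : X) 1, zeroExt g x = f x := fun x hx => zeroExt_of_mem g hx
  exact ⟨g, ⟨(hd.mono hsub).congr hg, hlip.uniformContinuous⟩, hg⟩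

theorem tendsto_apply_toWeakSpace_symm (l : StrongDual ℂ X) (x : X) :
    Tendsto (fun y : WeakSpace ℂ X => l ((toWeakSpace ℂ X).symm y)) (𝓝 (toWeakSpace ℂ X x))
      (𝓝 (l x)) :=
  (WeakBilin.eval_continuous (topDualPairing ℂ X).flip l).tendsto (toWeakSpace ℂ X x)

theorem exists_ultrafilter_not_tendsto {f : X → ℂ} (hf : ¬ IsWeaklyContinuousOnBall f) :
    ∃ x₀ ∈ ball (0 : X) 1, ∃ U : Ultrafilter X, ball (0 : X) 1 ∈ U ∧
      (∀ l : StrongDual ℂ X, Tendsto l U (𝓝 (l x₀))) ∧ ¬ Tendsto f U (𝓝 (f x₀)) := by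
  unfold IsWeaklyContinuousOnBall ContinuousOn ContinuousWithinAt at hf
  simp only [forall_mem_image] at hf
  push Not at hf
  obtain ⟨x₀, hx₀, hnot⟩ := hf
  rw [tendsto_iff_ultrafilter] at hnot
  push Not at hnot
  obtain ⟨U, hU, hUf⟩ := hnot
  refine ⟨x₀, hx₀, U.map (toWeakSpace ℂ X).symm, ?_, fun l => ?_, hUf⟩
  · filter_upwards [hU self_mem_nhdsWithin]
    rintro _ ⟨x, hx, rfl⟩
    exact hx
  · exact (tendsto_apply_toWeakSpace_symm l x₀).mono_left (hU.trans nhdsWithin_le_nhds)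

variable {𝒜 : Subalgebra ℂ (BallFun X)}

theorem mem_fiber_of_tendsto (h𝒜 : Au X ≤ 𝒜) {z : StrongDual ℂ (StrongDual ℂ X)} {G : Filter X}
    [G.NeBot] (hG : ball (0 : X) 1 ∈ G) (hz : ∀ l : StrongDual ℂ X, Tendsto l G (𝓝 (z l)))
    {φ : WeakDual.characterSpace ℂ 𝒜}
    (hφ : ∀ f : 𝒜, Tendsto (zeroExt (f : BallFun X)) G (𝓝 (φ f))) : φ ∈ fiber 𝒜 h𝒜 z := by
  refine ContinuousLinearMap.ext fun l => tendsto_nhds_unique (hφ (dualIncl 𝒜 h𝒜 l))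
    ((hz l).congr' ?_)
  filter_upwards [hG] with x hx
  exact (zeroExt_dualRestrict hx l).symm

theorem exists_mem_fiber_zero_ne_deltaZero {P : X → ℂ} (hP : IsEntireOfBoundedType P)
    (hPw : ¬ IsWeaklyContinuousOnBall P) (h𝒜 : Au X ≤ 𝒜) (h𝒜' : 𝒜 ≤ Hinf X) :
    ∃ φ ∈ fiber 𝒜 h𝒜 0, φ ≠ deltaZero 𝒜 ∧ φ ∈ gleasonPart (deltaZero 𝒜) := by
  obtain ⟨x₀, hx₀, U, hU, hUl, hUP⟩ := exists_ultrafilter_not_tendsto hPw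
  let T : X → X := fun x => (4 : ℂ)⁻¹ • (x - x₀)
  have hT : ∀ᶠ x in (U.map T : Filter X), ‖x‖ ≤ 1 / 2 := by
    rw [Ultrafilter.coe_map, eventually_map]
    filter_upwards [hU] with x hx
    rw [norm_smul, norm_inv, Complex.norm_ofNat]
    linarith [norm_sub_le x x₀, mem_ball_zero_iff.1 hx, mem_ball_zero_iff.1 hx₀]
  have hball : ball (0 : X) 1 ∈ (U.map T : Filter X) := by
    filter_upwards [hT] with x hx
    exact mem_ball_zero_iff.2 (hx.trans_lt one_half_lt_one)
  have hTl : ∀ l : StrongDual ℂ X, Tendsto l (U.map T) (𝓝 0) := fun l => by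
    have hlim := ((hUl l).sub_const (l x₀)).const_mul (4 : ℂ)⁻¹
    rw [sub_self, mul_zero] at hlim
    exact tendsto_map'_iff.2 (hlim.congr fun x => by simp [T])
  obtain ⟨φ, hφ, hφlim⟩ := exists_mem_gleasonPart_tendsto h𝒜' (U.map T) one_half_lt_one hT
  refine ⟨φ, mem_fiber_of_tendsto h𝒜 hball hTl hφlim, ?_, hφ⟩
  rintro rfl
  have hQ := hP.comp_add_smul x₀ 4
  obtain ⟨M, hM⟩ := hQ.2 2
  obtain ⟨g, hg, hgP⟩ := exists_mem_Au_eq one_lt_two hQ.1.differentiableOn hM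
  have hlim := hφlim ⟨g, h𝒜 hg⟩
  rw [← zeroExt_zero_eq_deltaZero, hgP 0 (mem_ball_self one_pos), smul_zero, add_zero] at hlim
  refine hUP ((tendsto_map'_iff.1 hlim).congr' ?_)
  filter_upwards [mem_map.1 hball] with x hx
  simp [hgP (T x) hx, T]

end Fiber

end GleasonParts

end

open GleasonParts in
theorem mainTheorem10_general {X : Type*} [NormedAddCommGroup X] [NormedSpace ℂ X]
    (hX : ∃ P : X → ℂ, IsEntireOfBoundedType P ∧ ¬ IsWeaklyContinuousOnBall P)
    (𝒜 : Subalgebra ℂ (BallFun X)) (h𝒜 : Au X ≤ 𝒜) (h𝒜' : 𝒜 ≤ Hinf X) :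
    Set.InjOn (delta 𝒜) (Metric.ball 0 1) ∧
    delta 𝒜 '' Metric.ball 0 1 ⊂
      (fun (φ : WeakDual.characterSpace ℂ 𝒜) (f : 𝒜) => φ f) '' gleasonPart (deltaZero 𝒜) ∧
    ∃ φ ∈ fiber 𝒜 h𝒜 0, φ ≠ deltaZero 𝒜 ∧ φ ∈ gleasonPart (deltaZero 𝒜) := by
  obtain ⟨P, hP, hPw⟩ := hX
  obtain ⟨φ, hφ_fiber, hφ_ne, hφ⟩ := exists_mem_fiber_zero_ne_deltaZero hP hPw h𝒜 h𝒜'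
  refine ⟨injOn_delta h𝒜, ⟨?_, fun hsub => ?_⟩, φ, hφ_fiber, hφ_ne, hφ⟩
  · rintro _ ⟨z, hz, rfl⟩
    obtain ⟨ψ, hψ, hψz⟩ := exists_mem_gleasonPart_eq_delta h𝒜' (norm_lt_one_of_mem_ball hz)
    exact ⟨ψ, hψ, funext hψz⟩
  · obtain ⟨z, hz, hφz⟩ := hsub ⟨φ, hφ, rfl⟩
    exact hφ_ne (eq_deltaZero_of_mem_fiber_zero h𝒜 hφ_fiber (norm_lt_one_of_mem_ball hz) fun f =>
      (congrFun hφz f).symm)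

open GleasonParts in
theorem mainTheorem10 {X : Type*} [NormedAddCommGroup X] [NormedSpace ℂ X] [CompleteSpace X]
    (hX : ∃ P : X → ℂ, IsContinuousPolynomial P ∧ ¬ IsWeaklyContinuousOnBall P)
    (𝒜 : Subalgebra ℂ (BallFun X)) (h𝒜 : Au X ≤ 𝒜) (h : 𝒜 = Au X ∨ 𝒜 = Hinf X) :
    Set.InjOn (delta 𝒜) (Metric.ball 0 1) ∧
    delta 𝒜 '' Metric.ball 0 1 ⊂
      (fun (φ : WeakDual.characterSpace ℂ 𝒜) (f : 𝒜) => φ f) '' gleasonPart (deltaZero 𝒜) ∧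
    ∃ φ ∈ fiber 𝒜 h𝒜 0, φ ≠ deltaZero 𝒜 ∧ φ ∈ gleasonPart (deltaZero 𝒜) := by
  obtain ⟨P, hP, hPw⟩ := hX
  exact mainTheorem10_general ⟨P, hP.isEntireOfBoundedType, hPw⟩ 𝒜 h𝒜
    (h.elim (fun hAu => hAu.trans_le (Au_le_Hinf X)) le_of_eq)
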